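/- For coprime integers $h,k$ with $k>0$ put $$B_1(h,k)=\sum_{j=1}^{k-1}(-1)^{j+\left[\frac{hj}{k}\right]}\left[\frac{hj}{k}\right],$$ where $[x]$ denotes the greatest integer not exceeding $x$ (so $B_1(h,1)=0$). \textbf{Theorem.} Let $h$ and $k$ be relatively prime integers with $k>0$. If $h$ and $k$ are odd, then $$B_1(h,k)=\frac{2h}{\pi}\sum_{\substack{n=1\\ 2n-1\not\equiv 0\ (\mathrm{mod}\ k)}}^{\infty}\frac{1}{2n-1}\tan\left(\frac{\pi h(2n-1)}{2k}\right)+\frac{1}{2k}-\frac12 ,$$ where the infinite series converges as the limit, as $N\to\infty$, of its partial sums over $1\le n\le N$. -/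

import Mathlib

open Filter Topology

/-- The sum `B₁(h,k) = ∑_{j=1}^{k-1} (-1)^(j + [hj/k]) [hj/k]`, an integer, where `[x]` is the
greatest integer not exceeding `x`. It is used for `k > 0`. -/
noncomputable def sumB1 (h k : ℤ) : ℤ :=
  ∑ j ∈ Finset.Icc 1 (k - 1),
    ((j + ⌊((h * j : ℤ) : ℚ) / (k : ℚ)⌋).negOnePow : ℤ) * ⌊((h * j : ℤ) : ℚ) / (k : ℚ)⌋

/-- The partial sum, over the `n` with `1 ≤ n ≤ N` and `2n - 1 ≢ 0 (mod k)`, of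
`tan (π h (2n - 1) / (2k)) / (2n - 1)`. -/
noncomputable def tanPartialSum (h k : ℤ) (N : ℕ) : ℝ :=
  ∑ n ∈ (Finset.Icc 1 N).filter (fun n : ℕ => ¬ (2 * (n : ℤ) - 1 ≡ 0 [ZMOD k])),
    1 / (2 * (n : ℝ) - 1) *
      Real.tan (Real.pi * (h : ℝ) * (2 * (n : ℝ) - 1) / (2 * (k : ℝ)))

/-! For odd `m` with `k ∤ m`, `tan (πm/2k) = (2/k) ∑ j (-1)^j sin (πmj/k)` over `0 ≤ j < k`; the sum
vanishes when `k ∣ m`, so with `m = h(2n-1)` the excluded `n` may be put back. Exchanging sums turns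
the tangent series into a finite combination of square-wave series at `πhj/k`, with limits
`(π/4)(-1)^[hj/k]` (`tendsto_squareWaveSum_mul_pi`). Hence `L = πS/(2k)`, where `S = ∑ j
(-1)^(j+[hj/k])` (`tendsto_tanPartialSum`). Write `hj = k[hj/k] + r`. As `h`, `k` are odd, `j +
[hj/k] ≡ r` mod 2; as they are coprime, `r` runs over all residues. So `k B₁ = hS - ∑ (-1)^r r = hS
- (k-1)/2`. -/

/-! ### Convergence of the square-wave series -/

/-- The `N`-th partial sum of the Fourier series of a square wave. -/
noncomputable def squareWaveSum (N : ℕ) (x : ℝ) : ℝ :=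
  ∑ i ∈ Finset.range N, Real.sin ((2 * (i : ℝ) + 1) * x) / (2 * (i : ℝ) + 1)

theorem hasDerivAt_squareWaveSum (N : ℕ) (x : ℝ) :
    HasDerivAt (squareWaveSum N) (∑ i ∈ Finset.range N, Real.cos ((2 * (i : ℝ) + 1) * x)) x := by
  unfold squareWaveSum
  refine HasDerivAt.fun_sum fun i _ => ?_
  have hi : (2 * (i : ℝ) + 1) ≠ 0 := by positivity
  have h := (((hasDerivAt_id x).const_mul (2 * (i : ℝ) + 1)).sin).div_const (2 * (i : ℝ) + 1)
  refine h.congr_deriv ?_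
  simp only [id]
  field_simp

theorem two_sin_mul_sum_cos_odd (N : ℕ) (x : ℝ) :
    2 * Real.sin x * ∑ i ∈ Finset.range N, Real.cos ((2 * (i : ℝ) + 1) * x) =
      Real.sin (2 * N * x) := by
  induction N with
  | zero => simp
  | succ n ih =>
    rw [Finset.sum_range_succ, mul_add, ih]
    have e1 : 2 * (n : ℝ) * x = (2 * (n : ℝ) + 1) * x - x := by ring
    have e2 : 2 * ((n + 1 : ℕ) : ℝ) * x = (2 * (n : ℝ) + 1) * x + x := by push_cast; ring
    rw [e1, e2, Real.sin_sub, Real.sin_add]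
    ring

theorem abs_squareWaveSum_sub_le {N : ℕ} (hN : 0 < N) {x : ℝ} (hx0 : 0 < x)
    (hx1 : x ≤ Real.pi / 2) :
    |squareWaveSum N x - squareWaveSum N (Real.pi / 2)| ≤
      (1 / (2 * Real.sin x) + (Real.pi / 2 - x) / (4 * Real.sin x ^ 2)) / N := by
  have hNr : (0 : ℝ) < N := by exact_mod_cast hN
  have hs : 0 < Real.sin x := Real.sin_pos_of_pos_of_lt_pi hx0 (by linarith [Real.pi_pos])
  have hmono : ∀ t ∈ Set.Icc x (Real.pi / 2), Real.sin x ≤ Real.sin t := fun t ht =>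
    Real.sin_le_sin_of_le_of_le_pi_div_two (by linarith) ht.2 ht.1
  -- Integration by parts: the added term cancels the oscillating derivative `sin (2Nt) / (2 sin t)`
  -- and leaves one of size `O(1/N)`.
  set F : ℝ → ℝ := fun t => squareWaveSum N t + Real.cos (2 * N * t) / (4 * N * Real.sin t)
    with hF
  have hderiv : ∀ t ∈ Set.Icc x (Real.pi / 2), HasDerivWithinAt F
      (-(Real.cos (2 * N * t) * Real.cos t) / (4 * N * Real.sin t ^ 2))
      (Set.Icc x (Real.pi / 2)) t := by
    intro t ht
    have hst : 0 < Real.sin t := hs.trans_le (hmono t ht)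
    have h1 := ((hasDerivAt_id t).const_mul (2 * (N : ℝ))).cos
    have h2 := (Real.hasDerivAt_sin t).const_mul (4 * (N : ℝ))
    have h3 := (hasDerivAt_squareWaveSum N t).add (h1.div h2 (by positivity))
    refine (h3.congr_deriv ?_).hasDerivWithinAt
    have h4 : ∑ i ∈ Finset.range N, Real.cos ((2 * (i : ℝ) + 1) * t) =
        Real.sin (2 * N * t) / (2 * Real.sin t) := by
      rw [← two_sin_mul_sum_cos_odd, mul_div_cancel_left₀ _ (by positivity)]
    rw [h4]
    simp only [id]
    field_simp
    ring
  have hbound : ∀ t ∈ Set.Icc x (Real.pi / 2),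
      ‖-(Real.cos (2 * N * t) * Real.cos t) / (4 * N * Real.sin t ^ 2)‖ ≤
        1 / (4 * N * Real.sin x ^ 2) := by
    intro t ht
    have hst := hmono t ht
    have hst0 : 0 < Real.sin t := hs.trans_le hst
    rw [Real.norm_eq_abs, abs_div, abs_neg, abs_mul,
      abs_of_pos (show (0 : ℝ) < 4 * N * Real.sin t ^ 2 by positivity)]
    have : |Real.cos (2 * N * t)| * |Real.cos t| ≤ 1 :=
      mul_le_one₀ (Real.abs_cos_le_one _) (abs_nonneg _) (Real.abs_cos_le_one _)
    gcongr
  have hmv := (convex_Icc x (Real.pi / 2)).norm_image_sub_le_of_norm_hasDerivWithin_le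
    hderiv hbound (Set.right_mem_Icc.2 hx1) (Set.left_mem_Icc.2 hx1)
  rw [Real.norm_eq_abs, Real.norm_eq_abs, abs_sub_comm x, abs_of_nonneg (sub_nonneg.2 hx1)] at hmv
  have hc : ∀ t ∈ Set.Icc x (Real.pi / 2),
      |Real.cos (2 * N * t) / (4 * N * Real.sin t)| ≤ 1 / (4 * N * Real.sin x) := by
    intro t ht
    have hst := hmono t ht
    have hst0 : 0 < Real.sin t := hs.trans_le hst
    rw [abs_div, abs_of_pos (show (0 : ℝ) < 4 * N * Real.sin t by positivity)]
    have := Real.abs_cos_le_one (2 * N * t)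
    gcongr
  have ha := abs_le.1 (hc x (Set.left_mem_Icc.2 hx1))
  have hb := abs_le.1 (hc _ (Set.right_mem_Icc.2 hx1))
  have hm := abs_le.1 hmv
  have hR : (1 / (2 * Real.sin x) + (Real.pi / 2 - x) / (4 * Real.sin x ^ 2)) / N =
      1 / (4 * N * Real.sin x) + 1 / (4 * N * Real.sin x) +
        1 / (4 * N * Real.sin x ^ 2) * (Real.pi / 2 - x) := by
    field_simp
    ring
  rw [hR, abs_le]
  simp only [hF] at hm
  constructor <;> linarith [hm.1, hm.2, ha.1, ha.2, hb.1, hb.2]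

theorem squareWaveSum_add_int_mul_pi (N : ℕ) (x : ℝ) (m : ℤ) :
    squareWaveSum N (x + m * Real.pi) = (m.negOnePow : ℤ) * squareWaveSum N x := by
  unfold squareWaveSum
  rw [Finset.mul_sum]
  refine Finset.sum_congr rfl fun i _ => ?_
  have e : (2 * (i : ℝ) + 1) * (x + m * Real.pi) =
      (2 * (i : ℝ) + 1) * x + (((2 * i + 1) * m : ℤ) : ℝ) * Real.pi := by push_cast; ring
  have hp : ((2 * (i : ℤ) + 1) * m).negOnePow = m.negOnePow := by
    rw [Int.negOnePow_eq_iff]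
    exact ⟨i * m, by ring⟩
  rw [e, Real.sin_add_int_mul_pi, ← Int.cast_negOnePow ℝ, hp, mul_div_assoc]

theorem squareWaveSum_pi_sub (N : ℕ) (x : ℝ) :
    squareWaveSum N (Real.pi - x) = squareWaveSum N x := by
  have h := squareWaveSum_add_int_mul_pi N (-x) 1
  have e : Real.pi - x = -x + (1 : ℤ) * Real.pi := by push_cast; ring
  rw [e, h]
  simp [squareWaveSum, neg_div]

/-- At `π/2` the series is Leibniz's; this fixes the constant for every other point. -/
theorem tendsto_squareWaveSum_pi_div_two :
    Tendsto (fun N => squareWaveSum N (Real.pi / 2)) atTop (𝓝 (Real.pi / 4)) := by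
  refine Real.tendsto_sum_pi_div_four.congr fun N => ?_
  unfold squareWaveSum
  refine Finset.sum_congr rfl fun i _ => ?_
  have e : (2 * (i : ℝ) + 1) * (Real.pi / 2) = Real.pi / 2 + i * Real.pi := by ring
  rw [e, Real.sin_add_nat_mul_pi, Real.sin_pi_div_two, mul_one]

theorem tendsto_squareWaveSum_of_le {x : ℝ} (hx0 : 0 < x) (hx1 : x ≤ Real.pi / 2) :
    Tendsto (fun N => squareWaveSum N x) atTop (𝓝 (Real.pi / 4)) := by
  have hz : Tendsto (fun N => squareWaveSum N x - squareWaveSum N (Real.pi / 2)) atTop (𝓝 0) := by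
    refine squeeze_zero_norm' ?_ (tendsto_const_div_atTop_nhds_zero_nat
      (1 / (2 * Real.sin x) + (Real.pi / 2 - x) / (4 * Real.sin x ^ 2)))
    filter_upwards [eventually_gt_atTop 0] with N hN
    exact abs_squareWaveSum_sub_le hN hx0 hx1
  simpa using hz.add tendsto_squareWaveSum_pi_div_two

/-- Pointwise convergence of the Fourier series of the square wave away from its jumps. -/
theorem tendsto_squareWaveSum_mul_pi {y : ℝ} (hy : (⌊y⌋ : ℝ) ≠ y) :
    Tendsto (fun N => squareWaveSum N (y * Real.pi)) atTop
      (𝓝 ((⌊y⌋.negOnePow : ℤ) * (Real.pi / 4))) := by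
  have hpi := Real.pi_pos
  have h0 : 0 < Int.fract y :=
    lt_of_le_of_ne (Int.fract_nonneg y) fun h => hy (by linarith [Int.floor_add_fract y])
  have h1 := Int.fract_lt_one y
  have hfr : Tendsto (fun N => squareWaveSum N (Int.fract y * Real.pi)) atTop
      (𝓝 (Real.pi / 4)) := by
    rcases le_or_gt (Int.fract y) (1 / 2) with h | h
    · exact tendsto_squareWaveSum_of_le (by positivity) (by nlinarith)
    · refine (tendsto_squareWaveSum_of_le (x := Real.pi - Int.fract y * Real.pi)
        (by nlinarith) (by nlinarith)).congr fun N => squareWaveSum_pi_sub N _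
  refine (hfr.const_mul _).congr fun N => ?_
  rw [← squareWaveSum_add_int_mul_pi, ← add_mul, add_comm, Int.floor_add_fract]

/-! ### Finite Fourier expansion of the tangent -/

/-- Summation by parts, from `2 cos (θ/2) sin (jθ) = sin (jθ + θ/2) + sin (jθ - θ/2)`. -/
theorem two_cos_mul_sum_alternating_mul_sin (n : ℕ) (θ : ℝ) :
    2 * Real.cos (θ / 2) * ∑ j ∈ Finset.range n, (j : ℝ) * ((-1) ^ j * Real.sin (j * θ)) =
      -(n * ((-1) ^ n * Real.sin (n * θ - θ / 2))) -
        ∑ j ∈ Finset.range n, (-1) ^ j * Real.sin (j * θ + θ / 2) := by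
  induction n with
  | zero => simp
  | succ n ih =>
    rw [Finset.sum_range_succ, Finset.sum_range_succ, mul_add, ih]
    have e : ((n + 1 : ℕ) : ℝ) * θ - θ / 2 = n * θ + θ / 2 := by push_cast; ring
    rw [e, Real.sin_sub, Real.sin_add]
    push_cast
    ring

theorem two_cos_mul_sum_alternating_sin (n : ℕ) (θ : ℝ) :
    2 * Real.cos (θ / 2) * ∑ j ∈ Finset.range n, (-1) ^ j * Real.sin (j * θ + θ / 2) =
      -((-1) ^ n * Real.sin (n * θ)) := by
  induction n with
  | zero => simp
  | succ n ih =>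
    rw [Finset.sum_range_succ, mul_add, ih]
    have e1 : ((n + 1 : ℕ) : ℝ) * θ = (n * θ + θ / 2) + θ / 2 := by push_cast; ring
    have e2 : (n : ℝ) * θ = (n * θ + θ / 2) - θ / 2 := by ring
    rw [e1, Real.sin_add (n * θ + θ / 2)]
    nth_rewrite 1 [e2]
    rw [Real.sin_sub (n * θ + θ / 2)]
    ring

/-- The finite Fourier expansion of the tangent at odd multiples of `π / (2k)`. -/
theorem sum_alternating_mul_sin_eq_tan {k : ℕ} {m : ℤ} (hk : Odd k) (hm : Odd m)
    (hkm : ¬ (k : ℤ) ∣ m) :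
    ∑ j ∈ Finset.range k, (j : ℝ) * ((-1) ^ j * Real.sin (j * (m * Real.pi / k))) =
      k / 2 * Real.tan (m * Real.pi / k / 2) := by
  have hk0 : (k : ℝ) ≠ 0 := by exact_mod_cast hk.pos.ne'
  set θ : ℝ := m * Real.pi / k with hθ
  have hkθ : k * θ = m * Real.pi := by rw [hθ]; field_simp
  have hcos : Real.cos (θ / 2) ≠ 0 := by
    rw [Real.cos_ne_zero_iff]
    intro l hl
    apply hkm
    refine ⟨2 * l + 1, ?_⟩
    have h1 : (m : ℝ) * Real.pi = (k * (2 * l + 1)) * Real.pi := by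
      rw [← hkθ]; linear_combination 2 * k * hl
    exact_mod_cast mul_right_cancel₀ Real.pi_ne_zero h1
  have h2 := two_cos_mul_sum_alternating_sin k θ
  rw [hkθ, Real.sin_int_mul_pi, mul_zero, neg_zero] at h2
  have h3 : ∑ j ∈ Finset.range k, (-1) ^ j * Real.sin (j * θ + θ / 2) = 0 :=
    (mul_eq_zero.1 h2).resolve_left (mul_ne_zero two_ne_zero hcos)
  have h4 := two_cos_mul_sum_alternating_mul_sin k θ
  rw [h3, hkθ, Real.sin_int_mul_pi_sub, hk.neg_one_pow, hm.neg_one_zpow] at h4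
  rw [Real.tan_eq_sin_div_cos]
  generalize ∑ j ∈ Finset.range k, (j : ℝ) * ((-1) ^ j * Real.sin (j * θ)) = T at *
  field_simp
  linarith

theorem sum_alternating_mul_sin_eq_zero {k : ℕ} {m : ℤ} (hkm : (k : ℤ) ∣ m) :
    ∑ j ∈ Finset.range k, (j : ℝ) * ((-1) ^ j * Real.sin (j * (m * Real.pi / k))) = 0 := by
  refine Finset.sum_eq_zero fun j hj => ?_
  obtain ⟨c, rfl⟩ := hkm
  have hk0 : (k : ℝ) ≠ 0 := by
    have := Finset.mem_range.1 hj
    exact_mod_cast (by omega : k ≠ 0)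
  have e : (j : ℝ) * (((k * c : ℤ) : ℝ) * Real.pi / k) = ((j * c : ℤ) : ℝ) * Real.pi := by
    push_cast; field_simp
  rw [e, Real.sin_int_mul_pi, mul_zero, mul_zero]

theorem tanPartialSum_eq {h : ℤ} {k : ℕ} (hk : Odd k) (hcop : IsCoprime h k) (hodd : Odd h)
    (N : ℕ) :
    tanPartialSum h k N = ∑ j ∈ Finset.range k,
      2 / (k : ℝ) * (j * (-1) ^ j) * squareWaveSum N (((h * j : ℤ) : ℝ) / k * Real.pi) := by
  have hk0 : (k : ℝ) ≠ 0 := by exact_mod_cast hk.pos.ne'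
  have key : tanPartialSum h k N = ∑ i ∈ Finset.range N, 2 / (k : ℝ) / (2 * (i : ℝ) + 1) *
      ∑ j ∈ Finset.range k, (j : ℝ) * ((-1) ^ j *
        Real.sin (j * (((h * (2 * i + 1) : ℤ) : ℝ) * Real.pi / k))) := by
    unfold tanPartialSum
    rw [Finset.sum_filter, ← Finset.Ico_add_one_right_eq_Icc, Finset.sum_Ico_eq_sum_range]
    refine Finset.sum_congr (by simp) fun i _ => ?_
    have hi : (2 * (i : ℝ) + 1) ≠ 0 := by positivity
    have e1 : 2 * ((1 + i : ℕ) : ℤ) - 1 = 2 * i + 1 := by push_cast; ring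
    have e2 : 2 * ((1 + i : ℕ) : ℝ) - 1 = 2 * i + 1 := by push_cast; ring
    have hm : Odd (h * (2 * (i : ℤ) + 1)) := hodd.mul ⟨i, rfl⟩
    simp only [e1, e2, Int.modEq_zero_iff_dvd]
    by_cases hd : (k : ℤ) ∣ 2 * i + 1
    · rw [if_neg (not_not.2 hd), sum_alternating_mul_sin_eq_zero (Dvd.dvd.mul_left hd h), mul_zero]
    · rw [if_pos hd,
        sum_alternating_mul_sin_eq_tan hk hm fun hh => hd (hcop.symm.dvd_of_dvd_mul_left hh)]
      have e3 : Real.pi * (h : ℝ) * (2 * (i : ℝ) + 1) / (2 * ((k : ℤ) : ℝ)) =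
          ((h * (2 * i + 1) : ℤ) : ℝ) * Real.pi / k / 2 := by
        push_cast; field_simp
      rw [e3]
      field_simp
  rw [key]
  simp only [squareWaveSum, Finset.mul_sum]
  rw [Finset.sum_comm]
  refine Finset.sum_congr rfl fun j _ => Finset.sum_congr rfl fun i _ => ?_
  have e : (j : ℝ) * (((h * (2 * i + 1) : ℤ) : ℝ) * Real.pi / k) =
      (2 * (i : ℝ) + 1) * (((h * j : ℤ) : ℝ) / k * Real.pi) := by
    push_cast; field_simp
  rw [e]
  field_simp

/-- The limit of the tangent series, as a finite sum. -/
theorem tendsto_tanPartialSum {h : ℤ} {k : ℕ} (hk : Odd k) (hcop : IsCoprime h k) (hodd : Odd h) :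
    Tendsto (fun N => tanPartialSum h k N) atTop
      (𝓝 (Real.pi / (2 * k) *
        ((∑ j ∈ Finset.range k, (j : ℤ) * ((j + h * j / k : ℤ).negOnePow : ℤ) : ℤ) : ℝ))) := by
  have hk0 : (k : ℝ) ≠ 0 := by exact_mod_cast hk.pos.ne'
  simp only [tanPartialSum_eq hk hcop hodd]
  push_cast
  rw [Finset.mul_sum]
  refine tendsto_finsetSum _ fun j hj => ?_
  -- `j = 0` sits at a jump but has weight 0; for `0 < j < k` coprimality keeps `hj/k` off the
  -- integers.
  rcases Nat.eq_zero_or_pos j with rfl | hj0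
  · simp
  have hfl : ⌊((h * j : ℤ) : ℝ) / k⌋ = h * j / k := by
    rw [Int.floor_div_natCast, Int.floor_intCast]
  have hne : (⌊((h * j : ℤ) : ℝ) / k⌋ : ℝ) ≠ ((h * j : ℤ) : ℝ) / k := by
    intro he
    rw [eq_div_iff hk0] at he
    have hd : (k : ℤ) ∣ h * j := by
      rw [hfl] at he
      exact Dvd.intro_left (h * j / k) (by exact_mod_cast he)
    have hd' : (k : ℤ) ∣ j := hcop.symm.dvd_of_dvd_mul_left hd
    have := Nat.le_of_dvd hj0 (Int.natCast_dvd_natCast.1 hd')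
    have := Finset.mem_range.1 hj
    omega
  have hc : (h : ℝ) * j = ((h * j : ℤ) : ℝ) := by push_cast; rfl
  rw [hc]
  convert! (tendsto_squareWaveSum_mul_pi hne).const_mul (2 / (k : ℝ) * (j * (-1) ^ j)) using 2
  rw [hfl, Int.negOnePow_add]
  push_cast
  have : (((j : ℤ).negOnePow : ℤ) : ℝ) = (-1) ^ j := by
    rw [Int.coe_negOnePow]; simp
  rw [this]
  field_simp
  ring

/-! ### Arithmetic evaluation of `B₁` -/

theorem sum_Icc_int_eq_sum_range {k : ℕ} (hk : 0 < k) (f : ℤ → ℤ) (hf : f 0 = 0) :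
    ∑ j ∈ Finset.Icc 1 ((k : ℤ) - 1), f j = ∑ j ∈ Finset.range k, f j := by
  obtain ⟨n, rfl⟩ := Nat.exists_eq_succ_of_ne_zero hk.ne'
  rw [Finset.sum_range_succ', Nat.cast_zero, hf, add_zero]
  symm
  refine Finset.sum_nbij (fun i : ℕ => ((i + 1 : ℕ) : ℤ)) ?_ ?_ ?_ fun _ _ => rfl
  · intro i hi
    have := Finset.mem_range.1 hi
    rw [Finset.mem_Icc]
    push_cast
    omega
  · intro a _ b _ hab
    simpa using hab
  · intro j hj
    have := Finset.mem_Icc.1 hj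
    push_cast at this
    exact ⟨(j - 1).toNat, by simp only [Finset.coe_range, Set.mem_Iio]; omega, by push_cast; omega⟩

theorem two_mul_sum_range_negOnePow_mul_self (n : ℕ) :
    2 * ∑ r ∈ Finset.range (2 * n + 1), ((r : ℤ).negOnePow : ℤ) * r = 2 * n := by
  induction n with
  | zero => simp
  | succ n ih =>
    rw [show 2 * (n + 1) + 1 = 2 * n + 1 + 1 + 1 by ring, Finset.sum_range_succ,
      Finset.sum_range_succ, mul_add, mul_add, ih,
      Int.negOnePow_odd _ ⟨(n : ℤ), by push_cast; ring⟩,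
      Int.negOnePow_even _ ⟨(n : ℤ) + 1, by push_cast; ring⟩]
    push_cast
    ring

theorem sum_range_mul_emod {h : ℤ} {k : ℕ} (hk : 0 < k) (hcop : IsCoprime h k) (f : ℤ → ℤ) :
    ∑ j ∈ Finset.range k, f (h * j % k) = ∑ r ∈ Finset.range k, f r := by
  have hk' : (0 : ℤ) < k := by exact_mod_cast hk
  have hnn : ∀ j : ℕ, 0 ≤ h * j % k := fun j => Int.emod_nonneg _ hk'.ne'
  have hlt : ∀ j : ℕ, h * j % k < k := fun j => Int.emod_lt_of_pos _ hk'
  have hmaps : ∀ j ∈ Finset.range k, (h * j % k).toNat ∈ Finset.range k := fun j _ => by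
    have h1 := hnn j
    have h2 := hlt j
    rw [Finset.mem_range]
    omega
  have hinj : Set.InjOn (fun j : ℕ => (h * j % k).toNat) (Finset.range k) := by
    intro a ha b hb hab
    have e : h * a % k = h * b % k := by
      have := hnn a
      have := hnn b
      simp only at hab
      omega
    have hd : (k : ℤ) ∣ h * (b - a) := by
      rw [mul_sub]; exact Int.ModEq.dvd e
    have hd' : (k : ℤ) ∣ b - a := hcop.symm.dvd_of_dvd_mul_left hd
    have hab' : (a : ℕ) ≡ b [MOD k] := (Nat.modEq_iff_dvd).2 hd'
    exact hab'.eq_of_lt_of_lt (Finset.mem_range.1 ha) (Finset.mem_range.1 hb)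
  refine Finset.sum_nbij (fun j : ℕ => (h * j % k).toNat) hmaps hinj
    (Finset.surjOn_of_injOn_of_card_le _ hmaps hinj le_rfl) fun j _ => ?_
  rw [Int.toNat_of_nonneg (hnn j)]

theorem negOnePow_add_ediv {h k : ℤ} (hodd : Odd h) (kodd : Odd k) (j : ℤ) :
    (j + h * j / k).negOnePow = (h * j % k).negOnePow := by
  rw [Int.negOnePow_eq_iff]
  obtain ⟨a, ha⟩ := hodd
  obtain ⟨b, hb⟩ := kodd
  -- With quotient `q` and `r = hj - kq`, `j + q - r = 2((b+1)q - aj)`.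
  refine ⟨(b + 1) * (h * j / k) - a * j, ?_⟩
  have := Int.mul_ediv_add_emod (h * j) k
  generalize h * j / k = q at *
  generalize h * j % k = r at *
  subst ha hb
  linear_combination -this

/-- Evaluation of `B₁(h,k)` in terms of the sum of `j (-1)^(j + [hj/k])`. -/
theorem two_mul_mul_sumB1 {h : ℤ} {k : ℕ} (hk : Odd k) (hcop : IsCoprime h k) (hodd : Odd h) :
    2 * (k * sumB1 h k) =
      2 * (h * ∑ j ∈ Finset.range k, (j : ℤ) * ((j + h * j / k : ℤ).negOnePow : ℤ)) -
        (k - 1) := by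
  have hB : sumB1 h k =
      ∑ j ∈ Finset.range k, ((j + h * j / k : ℤ).negOnePow : ℤ) * (h * j / k) := by
    rw [← sum_Icc_int_eq_sum_range hk.pos
      (fun j : ℤ => ((j + h * j / k : ℤ).negOnePow : ℤ) * (h * j / k)) (by simp)]
    unfold sumB1
    refine Finset.sum_congr rfl fun j _ => ?_
    have hfl : ⌊((h * j : ℤ) : ℚ) / ((k : ℤ) : ℚ)⌋ = h * j / k :=
      Rat.floor_intCast_div_natCast (h * j) k
    rw [hfl]
  have hr : k * sumB1 h k =
      h * ∑ j ∈ Finset.range k, (j : ℤ) * ((j + h * j / k : ℤ).negOnePow : ℤ) -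
        ∑ j ∈ Finset.range k, ((h * j % k : ℤ).negOnePow : ℤ) * (h * j % k) := by
    rw [hB, Finset.mul_sum, Finset.mul_sum, ← Finset.sum_sub_distrib]
    refine Finset.sum_congr rfl fun j _ => ?_
    rw [negOnePow_add_ediv hodd (by exact_mod_cast hk)]
    linear_combination ((h * j % k : ℤ).negOnePow : ℤ) * Int.mul_ediv_add_emod (h * j) k
  rw [hr, sum_range_mul_emod hk.pos hcop fun r => (r.negOnePow : ℤ) * r]
  obtain ⟨n, rfl⟩ := hk
  rw [mul_sub, two_mul_sum_range_negOnePow_mul_self]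
  push_cast
  ring

theorem mainTheorem10 (h k : ℤ) (hk : 0 < k) (hcop : IsCoprime h k)
    (hodd : Odd h) (kodd : Odd k) :
    ∃ L : ℝ, Tendsto (fun N : ℕ => tanPartialSum h k N) atTop (𝓝 L) ∧
      (sumB1 h k : ℝ) = 2 * (h : ℝ) / Real.pi * L + 1 / (2 * (k : ℝ)) - 1 / 2 := by
  lift k to ℕ using hk.le
  have kodd' : Odd k := by exact_mod_cast kodd
  refine ⟨_, tendsto_tanPartialSum kodd' hcop hodd, ?_⟩
  have hB := congrArg (Int.cast : ℤ → ℝ) (two_mul_mul_sumB1 kodd' hcop hodd)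
  generalize (∑ j ∈ Finset.range k, (j : ℤ) * ((j + h * j / k : ℤ).negOnePow : ℤ)) = S at *
  push_cast at hB ⊢
  have hk0 : (k : ℝ) ≠ 0 := by exact_mod_cast kodd'.pos.ne'
  field_simp
  linarith
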